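/- Let $\mathcal V$ be a finite set of $V=|\mathcal V|$ nodes and $\mathcal E\subseteq\mathcal V\times\mathcal V$ a set of $E=|\mathcal E|\ge 1$ directed edges, each with a probability $p_{uv}\in[0,1]$; put $G=(\mathcal V,\mathcal E,p)$ and let $d_{\max}$ be the maximum out-degree. In the independent cascade (IC) model started from a seed set $S_0$ (with $S_{-1}=\emptyset$), at each step $h\ge1$ every newly activated node $u\in S_{h-1}\setminus S_{h-2}$ tries once to activate each out-neighbour $v\notin S_{h-1}$ and succeeds independently with probability $p_{uv}$; $S_h$ is $S_{h-1}$ together with the nodes activated at step $h$. Let $\Phi(S_0)=S_{V-1}$ and $\sigma(S_0;G)=\mathbb E|\Phi(S_0)|$. Fix $k\in\mathbb N$ and let $S^*$ maximize $\sigma(S;G)$ over $S\subseteq\mathcal V$ with $|S|\le k$. Let $\alpha\in(0,1]$ and let $\mathtt{IM}$ be an $\alpha$-approximate solver: for every $w\in[0,1]^{\mathcal E}$ it returns a set $\mathtt{IM}(w)$ of at most $k$ nodes with $\sigma(\mathtt{IM}(w);w)\ge\alpha\max_{|S|\le k}\sigma(S;w)$, where $\sigma(\cdot;w)$ is the influence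 spread in $(\mathcal V,\mathcal E,w)$. The data are $n\ge1$ independent cascades $(S_{t,0},S_{t,1},\dots)$, $t=1,\dots,n$. In each of them every node $u$ belongs to the seed set $S_{t,0}$ independently with probability $q_u\in[0,1]$, and given $S_{t,0}$ the cascade follows the IC model on $G$. Only the active node sets are observed. Write $p_G(\bar v)=\Pr[v\notin S_{t,1}]$, and let $\tilde{\mathcal E}(S^*)$ be the set of edges $(u,v)\in\mathcal E$ that $S^*$ can trigger, i.e. with $\Pr[u\in\Phi(S^*)]>0$. Assume that $\eta\in(0,1]$ and $\gamma\in(0,1/2]$ satisfy $q_u\in[\gamma,1-\gamma]$ and $p_G(\bar v)\ge\eta$ for all $(u,v)\in\tilde{\mathcal E}(S^*)$. Let $\delta\in(0,1)$ and $L=\log(12nE/\delta)$. Given the data, the algorithm CLCB-IM-N does the following. For nodes $u,v$ let $n_{0,u}$, $n_{0,\bar u}$, $n_{1,\bar v}$ and $n_{1,\bar u,\bar v}$ be the number of $t$ with, respectively, $u\in S_{t,0}$; $u\notin S_{t,0}$; $v\notin S_{t,1}$; both $u\notin S_{t,0}$ and $v\notin S_{t,1}$. Let $\hat q_u=n_{0,u}/n$,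 $\hat p(\bar v)=n_{1,\bar v}/n$, $\hat p(\bar v|\bar u)=n_{1,\bar u,\bar v}/n_{0,\bar u}$, and $\rho(m,N)=\sqrt{6(1-m)mL/N}+9L/N$. Put $$\bar q_u=\min\{\hat q_u+\rho(\hat q_u,n),1\},\quad \bar p(\bar v)=\min\{\hat p(\bar v)+\rho(\hat p(\bar v),n),1\},\quad \underline p(\bar v|\bar u)=\max\{\hat p(\bar v|\bar u)-\rho(\hat p(\bar v|\bar u),n_{0,\bar u}),0\},$$ with $\underline p(\bar v|\bar u)=0$ if $n_{0,\bar u}=0$, and for $(u,v)\in\mathcal E$ $$\underline p_{uv}=\min\Big\{1,\max\Big\{0,\tfrac1{\bar q_u}\Big(1-\frac{\bar p(\bar v)}{\underline p(\bar v|\bar u)}\Big)\Big\}\Big\},$$ with $\underline p_{uv}=0$ if $\underline p(\bar v|\bar u)=0$. The algorithm returns $\hat S=\mathtt{IM}(\underline p)$. Theorem. If $n\ge\dfrac{392\log(12nE/\delta)}{\eta\gamma}$, then with probability at least $1-\delta$ over the data, $$\alpha\,\sigma(S^*;G)-\sigma(\hat S;G)\le48\sqrt6\,\sqrt{\frac{V^2\,d_{\max}^2\,\sigma(S^*;G)^2\,\log(12nE/\delta)}{\eta\,\gamma^3\,n}}.$$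 -/

import Mathlib

open MeasureTheory ProbabilityTheory unitInterval

namespace OfflineIM

variable {V : Type*} [Fintype V] [DecidableEq V] {E : Finset (V × V)}

/-! ### Independent cascade diffusion on a directed graph with edge set `E` -/

/-- One time step of the independent cascade. `prev` and `cur` are the active sets at the last two
time steps. Every newly activated node `u ∈ cur \ prev` makes one attempt on each inactive
out-neighbour `v`; the attempt succeeds iff the coin of the edge `(u, v)` shows `true`. (A node is
newly activated only once, so the coin of an edge is used at most once.) -/
def icStep (coin : E → Bool) (prev cur : Finset V) : Finset V :=
  cur ∪ Finset.univ.filter fun v =>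
    v ∉ cur ∧ ∃ u ∈ cur \ prev, ∃ h : (u, v) ∈ E, coin ⟨(u, v), h⟩ = true

/-- The influence cascade `S₀, S₁, S₂, …` of active sets, started with `S₋₁ = ∅` and `S₀`. -/
def cascade (coin : E → Bool) (S₀ : Finset V) : ℕ → Finset V
  | 0 => S₀
  | 1 => icStep coin ∅ S₀
  | h + 2 => icStep coin (cascade coin S₀ h) (cascade coin S₀ (h + 1))

/-- The final active set `Φ(S₀) = S_{|V| - 1}`. -/
def finalActive (coin : E → Bool) (S₀ : Finset V) : Finset V :=
  cascade coin S₀ (Fintype.card V - 1)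

/-- Independent tosses: coordinate `i` is `true` with probability `w i`. -/
noncomputable def tossMeasure {ι : Type*} [Fintype ι] (w : ι → I) : Measure (ι → Bool) :=
  Measure.pi fun i => bernoulliMeasure true false (w i)

instance {ι : Type*} [Fintype ι] (w : ι → I) : IsProbabilityMeasure (tossMeasure w) := by
  unfold tossMeasure; infer_instance

/-- The influence spread `σ(S₀; G) = 𝔼 |Φ(S₀)|` in the graph `G = (V, E, w)`. -/
noncomputable def spread (w : E → I) (S₀ : Finset V) : ℝ :=
  ∫ coin, ((finalActive coin S₀).card : ℝ) ∂(tossMeasure w)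

/-- The maximum out-degree. -/
def maxOutDegree (E : Finset (V × V)) : ℕ :=
  Finset.univ.sup fun u : V => (E.filter fun e => e.1 = u).card

/-- `S` maximizes the influence spread among the sets of at most `k` seeds. -/
def IsOptimalSeedSet (w : E → I) (k : ℕ) (S : Finset V) : Prop :=
  S.card ≤ k ∧ ∀ T : Finset V, T.card ≤ k → spread w T ≤ spread w S

/-- `IM` is an `α`-approximate influence maximization solver for cardinality `k`: for all edge
probabilities `w` it returns at most `k` seeds whose spread is at least `α` times the maximum. -/
def IsApproxSolver (k : ℕ) (α : ℝ) (IM : (E → I) → Finset V) : Prop :=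
  ∀ w : E → I, (IM w).card ≤ k ∧
    ∀ T : Finset V, T.card ≤ k → α * spread w T ≤ spread w (IM w)

/-- The edges that the seed set `S` can trigger: those whose source becomes active with positive
probability. -/
def triggeredEdges (w : E → I) (S : Finset V) : Set E :=
  {e | 0 < (tossMeasure w).real {coin | (e : V × V).1 ∈ finalActive coin S}}

/-! ### The offline data -/

/-- The randomness behind one cascade: which nodes are seeds, and the edge coins. -/
abbrev Sample (E : Finset (V × V)) : Type _ := (V → Bool) × (E → Bool)

/-- Node `u` is a seed with probability `q u`, independently over the nodes, and given the seeds
the diffusion is an independent cascade with edge probabilities `p`. -/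
noncomputable def sampleMeasure (q : V → I) (p : E → I) : Measure (Sample E) :=
  (tossMeasure q).prod (tossMeasure p)

instance (q : V → I) (p : E → I) : IsProbabilityMeasure (sampleMeasure q p) := by
  unfold sampleMeasure; infer_instance

/-- The influence cascade of a sample, which is all that the learner sees of it. -/
def observe (x : Sample E) : ℕ → Finset V :=
  cascade x.2 (Finset.univ.filter fun u => x.1 u = true)

/-- The law of `n` independent samples. -/
noncomputable def dataMeasure (n : ℕ) (q : V → I) (p : E → I) : Measure (Fin n → Sample E) :=
  Measure.pi fun _ => sampleMeasure q p

/-- The dataset `(S_{t,0}, S_{t,1}, …)`, `t = 1, …, n`, of observed cascades. -/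
def dataset {n : ℕ} (x : Fin n → Sample E) : Fin n → ℕ → Finset V := fun t => observe (x t)

/-- The probability `p_G(v̄) = Pr[v ∉ S_{t,1}]` that `v` is not active after one time step. -/
noncomputable def probInactive (q : V → I) (p : E → I) (v : V) : ℝ :=
  (sampleMeasure q p).real {x | v ∉ observe x 1}

/-! ### The algorithm -/

section Algorithm

variable {n : ℕ} (D : Fin n → ℕ → Finset V)

/-- `n_{0,u}`: the number of cascades with seed `u`. -/
def cntSeed (u : V) : ℕ := (Finset.univ.filter fun t => u ∈ D t 0).card

/-- `n_{0,ū}`: the number of cascades without seed `u`. -/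
def cntNotSeed (u : V) : ℕ := (Finset.univ.filter fun t => u ∉ D t 0).card

/-- `n_{1,v̄}`: the number of cascades where `v` is inactive after one step. -/
def cntInactive (v : V) : ℕ := (Finset.univ.filter fun t => v ∉ D t 1).card

/-- `n_{1,ū,v̄}`: the number of cascades where `u` is no seed and `v` is inactive after one step. -/
def cntNotSeedInactive (u v : V) : ℕ :=
  (Finset.univ.filter fun t => u ∉ D t 0 ∧ v ∉ D t 1).card

/-- The variance-adaptive radius `√(6 (1 - m̂) m̂ L / N) + 9 L / N` of an empirical mean `m̂` of `N`
observations, with logarithmic factor `L`. -/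
noncomputable def radius (L m N : ℝ) : ℝ := √(6 * (1 - m) * m * L / N) + 9 * L / N

/-- The upper confidence bound for `q_u`. -/
noncomputable def ucbSeed (L : ℝ) (u : V) : ℝ :=
  min ((cntSeed D u : ℝ) / n + radius L ((cntSeed D u : ℝ) / n) n) 1

/-- The upper confidence bound for `p(v̄)`. -/
noncomputable def ucbInactive (L : ℝ) (v : V) : ℝ :=
  min ((cntInactive D v : ℝ) / n + radius L ((cntInactive D v : ℝ) / n) n) 1

/-- The lower confidence bound for `p(v̄ | ū)`. It is `0` if there are no observations. -/
noncomputable def lcbCondInactive (L : ℝ) (u v : V) : ℝ :=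
  if cntNotSeed D u = 0 then 0
  else
    max ((cntNotSeedInactive D u v : ℝ) / cntNotSeed D u -
      radius L ((cntNotSeedInactive D u v : ℝ) / cntNotSeed D u) (cntNotSeed D u)) 0

/-- The lower confidence bound `min {1, max {0, (1 / q̄_u) (1 - p̄(v̄) / p̲(v̄ | ū))}}` for `p_{uv}`.
If `p̲(v̄ | ū) = 0`, the inner quotient of a positive number by `0` is read as `+∞`, so that the
bound is `0`. -/
noncomputable def edgeLCB (L : ℝ) (e : V × V) : I :=
  if lcbCondInactive D L e.1 e.2 = 0 then 0
  else
    ⟨min 1 (max 0 (1 / ucbSeed D L e.1 *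
        (1 - ucbInactive D L e.2 / lcbCondInactive D L e.1 e.2))),
      le_min zero_le_one (le_max_left _ _), min_le_left _ _⟩

/-- The logarithmic factor `log (12 n |E| / δ)`. -/
noncomputable def logFactor (n : ℕ) (E : Finset (V × V)) (δ : ℝ) : ℝ :=
  Real.log (12 * n * E.card / δ)

/-- The algorithm: run the solver on the graph of lower confidence bounds. -/
noncomputable def clcbIMN (E : Finset (V × V)) (IM : (E → I) → Finset V) (δ : ℝ) : Finset V :=
  IM fun e => edgeLCB D (logFactor n E δ) e

end Algorithm

end OfflineIM

/-!
The algorithm is pessimistic: with high probability its edge weights `w` are lower bounds of the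
true probabilities `p`. The influence spread is monotone in the edge probabilities, so
`α σ(S*; p) - σ(Ŝ; p) ≤ α σ(S*; p) - σ(Ŝ; w) ≤ α (σ(S*; p) - σ(S*; w))`, and only the drop of the
spread of the single set `S*` has to be controlled (`gap_le_of_edge_bounds`).

*Smoothness.* The final active set is the closure of the seeds under the live edges
(`liveClosed_finalActive`, `LiveClosed.finalActive_subset`). Hence the coin of an edge matters only
if its source becomes active, an event which does not depend on that coin. Changing the biases of
the coins one at a time gives
`σ(S; p) - σ(S; w) ≤ |V| ∑ₑ (pₑ - wₑ) Pr[the source of e becomes active]` (`spread_sub_le`). Edges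
that `S*` cannot trigger drop out, and the remaining sum of probabilities is at most `d_max σ(S*; p)`.

*Estimation.* Apart from self-loops, `p(v̄) = p(v̄ | ū) (1 - q_u p_{uv})` (`probInactive_eq`), which
is solved for `p_{uv}` by the plug-in estimator. At a self-loop this identity, and with it the lower
bound, can fail, but self-loops have no influence on the spread (`spread_congr`). All relative
frequencies satisfy a Bernstein bound with the true variance (`measureReal_not_bernsteinClose_le`).
The conditional frequency has a random number `m` of observations; a union bound over `m` is used,
each term being a Chernoff bound whose exponent vanishes on samples outside the conditioning
event. The confidence radius of the algorithm, with its empirical variance,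
dominates the Bernstein radius (`BernsteinClose.abs_sub_le_radius`). Under the coverage assumption
all three confidence bounds have relative error of order `t = √(L / (η γ n))`, so that the error of
the edge weight is of order `t / γ` (`GoodData.sub_edgeLCB_le`).
-/

namespace OfflineIM

/-! ### Independent tosses -/

section Toss

variable {ι : Type*} [Fintype ι] [DecidableEq ι]

/-- Resampling coordinate `i` with a new bias `a` turns `tossMeasure w` into the toss measure whose
`i`-th bias is `a`. -/
lemma map_update_tossMeasure (w : ι → I) (i : ι) (a : I) :
    ((bernoulliMeasure true false a).prod (tossMeasure w)).map
      (fun z : Bool × (ι → Bool) => Function.update z.2 i z.1)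
      = tossMeasure (Function.update w i a) := by
  symm
  refine Measure.pi_eq fun s _ => ?_
  rw [Measure.map_apply .of_discrete .of_discrete]
  have hpre : (fun z : Bool × (ι → Bool) => Function.update z.2 i z.1) ⁻¹' Set.univ.pi s
      = s i ×ˢ Set.univ.pi (Function.update s i Set.univ) := by
    ext ⟨b, x⟩
    simp only [Set.mem_preimage, Set.mem_pi, Set.mem_univ, true_implies, Set.mem_prod]
    constructor
    · intro h
      refine ⟨by simpa using h i, fun j => ?_⟩
      rcases eq_or_ne j i with rfl | hj
      · simp
      · simpa [hj] using h j
    · rintro ⟨h₁, h₂⟩ j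
      rcases eq_or_ne j i with rfl | hj
      · simpa using h₁
      · simpa [hj] using h₂ j
  rw [hpre, Measure.prod_prod, tossMeasure, Measure.pi_pi,
    ← Finset.mul_prod_erase _ _ (Finset.mem_univ i),
    ← Finset.mul_prod_erase Finset.univ
      (fun j => bernoulliMeasure true false (Function.update w i a j) (s j)) (Finset.mem_univ i)]
  simp only [Function.update_self, measure_univ, one_mul]
  congr 1
  refine Finset.prod_congr rfl fun j hj => ?_
  rw [Function.update_of_ne (Finset.ne_of_mem_erase hj),
    Function.update_of_ne (Finset.ne_of_mem_erase hj)]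

/-- Conditioning on the toss `i`: the expectation is affine in the bias of that toss. -/
lemma integral_tossMeasure_update (w : ι → I) (i : ι) (a : I) (f : (ι → Bool) → ℝ) :
    ∫ x, f x ∂(tossMeasure (Function.update w i a))
      = a * ∫ x, f (Function.update x i true) ∂(tossMeasure w)
        + (1 - a) * ∫ x, f (Function.update x i false) ∂(tossMeasure w) := by
  rw [← map_update_tossMeasure, integral_map Measurable.of_discrete.aemeasurable
    Measurable.of_discrete.aestronglyMeasurable, integral_prod _ .of_finite]
  simp [integral_bernoulliMeasure]

lemma integral_tossMeasure_split (w : ι → I) (i : ι) (f : (ι → Bool) → ℝ) :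
    ∫ x, f x ∂(tossMeasure w)
      = w i * ∫ x, f (Function.update x i true) ∂(tossMeasure w)
        + (1 - w i) * ∫ x, f (Function.update x i false) ∂(tossMeasure w) := by
  simpa using integral_tossMeasure_update w i (w i) f

lemma integral_tossMeasure_sub_update (w : ι → I) (i : ι) (a : I) (f : (ι → Bool) → ℝ) :
    ∫ x, f x ∂(tossMeasure w) - ∫ x, f x ∂(tossMeasure (Function.update w i a))
      = (w i - a) * ∫ x, (f (Function.update x i true) - f (Function.update x i false))
          ∂(tossMeasure w) := by
  rw [integral_tossMeasure_split w i f, integral_tossMeasure_update,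
    integral_sub .of_finite .of_finite]
  ring

/-- Telescoping over the coordinates: if every change of a single bias from `w i` to `w' i`, with
all other biases taken from `w` or `w'`, lowers the expectation of `f` by at most `B i`, then the
change of all biases lowers it by at most `∑ i, B i`. -/
lemma integral_tossMeasure_sub_le (w w' : ι → I) (f : (ι → Bool) → ℝ) (B : ι → ℝ)
    (hB : ∀ i (h : ι → I), (∀ j, h j = w j ∨ h j = w' j) →
      ((w i : ℝ) - w' i) * ∫ x, (f (Function.update x i true) - f (Function.update x i false))
          ∂(tossMeasure h) ≤ B i) :
    ∫ x, f x ∂(tossMeasure w) - ∫ x, f x ∂(tossMeasure w') ≤ ∑ i, B i := by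
  suffices H : ∀ s : Finset ι, ∫ x, f x ∂(tossMeasure w)
      - ∫ x, f x ∂(tossMeasure (s.piecewise w' w)) ≤ ∑ i ∈ s, B i by
    simpa using H Finset.univ
  intro s
  induction s using Finset.induction_on with
  | empty => simp
  | insert i s hi ih =>
    rw [Finset.sum_insert hi, Finset.piecewise_insert]
    have h := integral_tossMeasure_sub_update (s.piecewise w' w) i (w' i) f
    have hb := hB i (s.piecewise w' w) fun j => by
      by_cases hj : j ∈ s <;> simp [hj]
    rw [Finset.piecewise_eq_of_notMem _ _ _ hi] at h
    linarith

lemma integral_tossMeasure_mono {w w' : ι → I} (hw : w' ≤ w) {f : (ι → Bool) → ℝ}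
    (hf : ∀ i x, f (Function.update x i false) ≤ f (Function.update x i true)) :
    ∫ x, f x ∂(tossMeasure w') ≤ ∫ x, f x ∂(tossMeasure w) := by
  have := integral_tossMeasure_sub_le w' w f 0 fun i h _ =>
    mul_nonpos_of_nonpos_of_nonneg (sub_nonpos.2 (hw i))
      (integral_nonneg fun x => sub_nonneg.2 (hf i x))
  simpa using this

/-- Coordinates that `f` ignores may be given any bias. -/
lemma integral_tossMeasure_congr {w w' : ι → I} {f : (ι → Bool) → ℝ}
    (hf : ∀ i, w i ≠ w' i → ∀ x, f (Function.update x i true) = f (Function.update x i false)) :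
    ∫ x, f x ∂(tossMeasure w) = ∫ x, f x ∂(tossMeasure w') := by
  have key : ∀ i (h : ι → I), ((w i : ℝ) - w' i) *
      ∫ x, (f (Function.update x i true) - f (Function.update x i false)) ∂(tossMeasure h) = 0 := by
    intro i h
    by_cases hi : w i = w' i
    · simp [hi]
    · simp [hf i hi]
  refine le_antisymm (sub_nonpos.1 ?_) (sub_nonpos.1 ?_)
  · simpa using integral_tossMeasure_sub_le w w' f 0 fun i h _ => (key i h).le
  · refine (integral_tossMeasure_sub_le w' w f 0 fun i h _ => le_of_eq ?_).trans (by simp)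
    have := key i h
    simp only [Pi.zero_apply]
    linarith

/-- If toss `i` can raise the value of the increasing function `f` by at most `K` times the
increasing function `g i`, then raising the biases from `w'` to `w` raises the expectation of `f`
by at most `K` times the sum of the bias differences weighted with the expectations of `g i`. -/
lemma integral_tossMeasure_sub_le_sum {w w' : ι → I} (hw : w' ≤ w) {f : (ι → Bool) → ℝ}
    {g : ι → (ι → Bool) → ℝ} {K : ℝ} (hK : 0 ≤ K)
    (hg : ∀ i j x, g i (Function.update x j false) ≤ g i (Function.update x j true))
    (hf : ∀ i x, f (Function.update x i true) - f (Function.update x i false) ≤ K * g i x) :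
    ∫ x, f x ∂(tossMeasure w) - ∫ x, f x ∂(tossMeasure w')
      ≤ ∑ i, ((w i : ℝ) - w' i) * (K * ∫ x, g i x ∂(tossMeasure w)) := by
  refine integral_tossMeasure_sub_le w w' f _ fun i h hh => ?_
  refine mul_le_mul_of_nonneg_left ?_ (sub_nonneg.2 (hw i))
  have hhw : h ≤ w := fun j => by
    rcases hh j with hj | hj
    · exact hj.le
    · exact hj.trans_le (hw j)
  calc ∫ x, (f (Function.update x i true) - f (Function.update x i false)) ∂(tossMeasure h)
      ≤ ∫ x, K * g i x ∂(tossMeasure h) := integral_mono .of_finite .of_finite (hf i)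
    _ = K * ∫ x, g i x ∂(tossMeasure h) := integral_const_mul _ _
    _ ≤ _ := mul_le_mul_of_nonneg_left (integral_tossMeasure_mono hhw (hg i)) hK

end Toss

/-! ### The final active set as a reachability closure -/

section Cascade

variable {V : Type*} [Fintype V] [DecidableEq V] {E : Finset (V × V)}

/-- `T` is closed under the edges whose coin shows `true`. -/
def LiveClosed (coin : E → Bool) (T : Finset V) : Prop :=
  ∀ e : E, coin e = true → (e : V × V).1 ∈ T → (e : V × V).2 ∈ T

lemma mem_icStep {coin : E → Bool} {prev cur : Finset V} {v : V} :
    v ∈ icStep coin prev cur ↔ v ∈ cur ∨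
      ∃ u ∈ cur \ prev, ∃ h : (u, v) ∈ E, coin ⟨(u, v), h⟩ = true := by
  simp only [icStep, Finset.mem_union, Finset.mem_filter, Finset.mem_univ, true_and]
  tauto

lemma subset_icStep (coin : E → Bool) (prev cur : Finset V) : cur ⊆ icStep coin prev cur :=
  fun _ hv => mem_icStep.2 (.inl hv)

lemma LiveClosed.icStep_subset {coin : E → Bool} {T : Finset V} (hT : LiveClosed coin T)
    {prev cur : Finset V} (hc : cur ⊆ T) : icStep coin prev cur ⊆ T := by
  intro v hv
  rcases mem_icStep.1 hv with hv | ⟨u, hu, h, hcoin⟩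
  · exact hc hv
  · exact hT ⟨(u, v), h⟩ hcoin (hc (Finset.mem_sdiff.1 hu).1)

lemma cascade_mono (coin : E → Bool) (S : Finset V) : Monotone (cascade coin S) := by
  refine monotone_nat_of_le_succ fun h => ?_
  cases h with
  | zero => exact subset_icStep coin ∅ S
  | succ h => exact subset_icStep coin _ _

lemma LiveClosed.cascade_subset {coin : E → Bool} {S T : Finset V} (hT : LiveClosed coin T)
    (hS : S ⊆ T) (h : ℕ) : cascade coin S h ⊆ T := by
  induction h with
  | zero => exact hS
  | succ h ih =>
    cases h with
    | zero => exact hT.icStep_subset hS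
    | succ h => exact hT.icStep_subset ih

/-- A live edge is used at the step after the activation of its source. -/
lemma mem_cascade_succ {coin : E → Bool} {S : Finset V} {e : E} (he : coin e = true) {h : ℕ}
    (hu : (e : V × V).1 ∈ cascade coin S h) : (e : V × V).2 ∈ cascade coin S (h + 1) := by
  induction h with
  | zero => exact mem_icStep.2 (.inr ⟨_, by simpa [cascade] using hu, e.2, he⟩)
  | succ h ih =>
    by_cases hu' : (e : V × V).1 ∈ cascade coin S h
    · exact cascade_mono coin S (Nat.le_succ _) (ih hu')
    · exact mem_icStep.2 (.inr ⟨_, Finset.mem_sdiff.2 ⟨hu, hu'⟩, e.2, he⟩)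

lemma cascade_succ_eq_of_eq {coin : E → Bool} {S : Finset V} {h : ℕ}
    (heq : cascade coin S (h + 1) = cascade coin S h) :
    cascade coin S (h + 2) = cascade coin S (h + 1) := by
  ext v
  rw [show cascade coin S (h + 2)
      = icStep coin (cascade coin S h) (cascade coin S (h + 1)) from rfl, heq, mem_icStep]
  simp

lemma cascade_empty (coin : E → Bool) (h : ℕ) : cascade coin ∅ h = ∅ :=
  Finset.subset_empty.1 (LiveClosed.cascade_subset (fun _ _ h => by simp at h) subset_rfl h)

/-- As long as the cascade has not stopped, it gains a node in every step. -/
lemma card_add_le_card_cascade {coin : E → Bool} {S : Finset V} {h : ℕ}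
    (hne : cascade coin S (h + 1) ≠ cascade coin S h) :
    S.card + (h + 1) ≤ (cascade coin S (h + 1)).card := by
  have hlt : ∀ h, cascade coin S (h + 1) ≠ cascade coin S h →
      (cascade coin S h).card + 1 ≤ (cascade coin S (h + 1)).card := fun h hne =>
    Finset.card_lt_card ((cascade_mono coin S (Nat.le_succ h)).lt_of_ne hne.symm)
  induction h with
  | zero => exact hlt 0 hne
  | succ h ih =>
    have := ih fun heq => hne (cascade_succ_eq_of_eq heq)
    have := hlt _ hne
    omega

lemma cascade_card_eq_finalActive (coin : E → Bool) (S : Finset V) :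
    cascade coin S (Fintype.card V - 1 + 1) = finalActive coin S := by
  by_contra hne
  have h₁ := card_add_le_card_cascade hne
  have h₂ := Finset.card_le_univ (cascade coin S (Fintype.card V - 1 + 1))
  obtain rfl : S = ∅ := Finset.card_eq_zero.1 (by omega)
  exact hne (by simp [finalActive, cascade_empty])

/-- The final active set is closed under the live edges: after `|V| - 1` steps the cascade has
stopped. -/
lemma liveClosed_finalActive (coin : E → Bool) (S : Finset V) :
    LiveClosed coin (finalActive coin S) := fun _ he hu => by
  rw [← cascade_card_eq_finalActive]
  exact mem_cascade_succ he hu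

lemma subset_finalActive (coin : E → Bool) (S : Finset V) : S ⊆ finalActive coin S :=
  cascade_mono coin S (Nat.zero_le _)

lemma LiveClosed.finalActive_subset {coin : E → Bool} {S T : Finset V} (hT : LiveClosed coin T)
    (hS : S ⊆ T) : finalActive coin S ⊆ T :=
  hT.cascade_subset hS _

/-- More live edges activate more nodes. -/
lemma finalActive_update_false_subset (coin : E → Bool) (S : Finset V) (e : E) :
    finalActive (Function.update coin e false) S ⊆ finalActive (Function.update coin e true) S := by
  refine LiveClosed.finalActive_subset (fun e' he' hu => ?_) (subset_finalActive _ _)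
  refine liveClosed_finalActive _ _ e' ?_ hu
  rcases eq_or_ne e' e with rfl | hne
  · simp
  · simpa [hne] using he'

/-- The coin of an edge with inactive source is irrelevant. -/
lemma finalActive_update_subset_of_notMem {coin : E → Bool} {S : Finset V} {e : E} {b b' : Bool}
    (hu : (e : V × V).1 ∉ finalActive (Function.update coin e b) S) :
    finalActive (Function.update coin e b') S ⊆ finalActive (Function.update coin e b) S := by
  refine LiveClosed.finalActive_subset (fun e' he' hu' => ?_) (subset_finalActive _ _)
  rcases eq_or_ne e' e with rfl | hne
  · exact absurd hu' hu
  · exact liveClosed_finalActive _ _ e' (by simpa [hne] using he') hu'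

/-- Whether the source of an edge becomes active does not depend on the coin of that edge. -/
lemma source_mem_finalActive_update_iff (coin : E → Bool) (S : Finset V) (e : E) (b : Bool) :
    (e : V × V).1 ∈ finalActive (Function.update coin e b) S
      ↔ (e : V × V).1 ∈ finalActive coin S := by
  have key : ∀ b b' : Bool, (e : V × V).1 ∈ finalActive (Function.update coin e b) S →
      (e : V × V).1 ∈ finalActive (Function.update coin e b') S := fun b b' h => by
    by_contra h'
    exact h' (finalActive_update_subset_of_notMem h' h)
  have h := key b (coin e)
  have h' := key (coin e) b
  rw [Function.update_eq_self] at h h'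
  exact ⟨h, h'⟩

/-- A self-loop never activates anything. -/
lemma finalActive_update_of_loop (coin : E → Bool) (S : Finset V) {e : E}
    (he : (e : V × V).1 = (e : V × V).2) (b b' : Bool) :
    finalActive (Function.update coin e b) S = finalActive (Function.update coin e b') S := by
  have key : ∀ b b', finalActive (Function.update coin e b) S
      ⊆ finalActive (Function.update coin e b') S := fun b b' => by
    refine LiveClosed.finalActive_subset (fun e' he' hu' => ?_) (subset_finalActive _ _)
    rcases eq_or_ne e' e with rfl | hne
    · exact he ▸ hu'
    · exact liveClosed_finalActive _ _ e' (by simpa [hne] using he') hu'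
  exact (key b b').antisymm (key b' b)

/-! ### Smoothness of the influence spread -/

lemma spread_mono {w w' : E → I} (hw : w' ≤ w) (S : Finset V) : spread w' S ≤ spread w S :=
  integral_tossMeasure_mono hw fun e coin =>
    Nat.cast_le.2 (Finset.card_le_card (finalActive_update_false_subset coin S e))

lemma spread_congr {w w' : E → I} (hw : ∀ e : E, (e : V × V).1 ≠ (e : V × V).2 → w e = w' e)
    (S : Finset V) : spread w S = spread w' S :=
  integral_tossMeasure_congr fun e he coin => by
    rw [finalActive_update_of_loop coin S (not_not.1 fun h => he (hw e h)) true false]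

/-- The probability that `u` becomes active when the seeds are `S`. -/
noncomputable def activeProb (w : E → I) (S : Finset V) (u : V) : ℝ :=
  ∫ coin, (if u ∈ finalActive coin S then 1 else 0) ∂(tossMeasure w)

lemma activeProb_eq_measureReal (w : E → I) (S : Finset V) (u : V) :
    activeProb w S u = (tossMeasure w).real {coin | u ∈ finalActive coin S} := by
  rw [← integral_indicator_one .of_discrete]
  simp only [activeProb, Set.indicator_apply, Set.mem_ofPred_eq, Pi.one_apply]

lemma activeProb_nonneg (w : E → I) (S : Finset V) (u : V) : 0 ≤ activeProb w S u := by
  rw [activeProb_eq_measureReal]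
  exact measureReal_nonneg

lemma sum_activeProb (w : E → I) (S : Finset V) : ∑ u, activeProb w S u = spread w S := by
  simp only [activeProb, spread]
  rw [← integral_finsetSum _ fun _ _ => .of_finite]
  simp

lemma spread_nonneg (w : E → I) (S : Finset V) : 0 ≤ spread w S :=
  integral_nonneg fun _ => Nat.cast_nonneg _

/-- Smoothness of the influence spread, modulated by the triggering probabilities: an edge matters
only if its source becomes active, and it then decides over at most `|V|` nodes. -/
lemma spread_sub_le {w w' : E → I} (hw : w' ≤ w) (S : Finset V) :
    spread w S - spread w' S
      ≤ ∑ e : E, ((w e : ℝ) - w' e) * (Fintype.card V * activeProb w S (e : V × V).1) := by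
  refine integral_tossMeasure_sub_le_sum hw (Nat.cast_nonneg _)
    (g := fun e coin => if (e : V × V).1 ∈ finalActive coin S then 1 else 0) ?_ ?_
  · intro e e' coin
    have := finalActive_update_false_subset coin S e' (x := (e : V × V).1)
    split_ifs <;> simp_all
  · intro e coin
    split_ifs with h
    · have : ((finalActive (Function.update coin e true) S).card : ℝ) ≤ Fintype.card V :=
        Nat.cast_le.2 (Finset.card_le_univ _)
      have : (0 : ℝ) ≤ (finalActive (Function.update coin e false) S).card := Nat.cast_nonneg _
      linarith
    · rw [← source_mem_finalActive_update_iff coin S e false] at h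
      rw [mul_zero, sub_nonpos, Nat.cast_le]
      exact Finset.card_le_card (finalActive_update_subset_of_notMem h)

lemma sum_activeProb_source_le (w : E → I) (S : Finset V) :
    ∑ e : E, activeProb w S (e : V × V).1 ≤ maxOutDegree E * spread w S := by
  rw [Finset.sum_coe_sort E fun e => activeProb w S e.1,
    ← Finset.sum_fiberwise E (fun e : V × V => e.1), ← sum_activeProb, Finset.mul_sum]
  refine Finset.sum_le_sum fun u _ => ?_
  calc ∑ e ∈ E with e.1 = u, activeProb w S e.1
      = ∑ e ∈ E with e.1 = u, activeProb w S u :=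
        Finset.sum_congr rfl fun e he => by rw [(Finset.mem_filter.1 he).2]
    _ = (E.filter fun e => e.1 = u).card * activeProb w S u := by simp
    _ ≤ _ := mul_le_mul_of_nonneg_right (Nat.cast_le.2 (Finset.le_sup
        (f := fun u : V => (E.filter fun e => e.1 = u).card) (Finset.mem_univ u)))
        (activeProb_nonneg w S u)

/-- If the edge probabilities drop by at most `ε` on the edges that `S` can trigger, the spread of
`S` drops by at most `ε |V| d_max` times itself. -/
lemma spread_sub_le_of_triggered {w w' : E → I} (hw : w' ≤ w) (S : Finset V) {ε : ℝ} (hε₀ : 0 ≤ ε)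
    (hε : ∀ e ∈ triggeredEdges w S, (w e : ℝ) - w' e ≤ ε) :
    spread w S - spread w' S
      ≤ ε * (Fintype.card V * (maxOutDegree E * spread w S)) := by
  calc spread w S - spread w' S
      ≤ ∑ e : E, ((w e : ℝ) - w' e) * (Fintype.card V * activeProb w S (e : V × V).1) :=
        spread_sub_le hw S
    _ ≤ ∑ e : E, ε * (Fintype.card V * activeProb w S (e : V × V).1) := by
        refine Finset.sum_le_sum fun e _ => ?_
        have h₀ := activeProb_nonneg w S (e : V × V).1
        by_cases he : e ∈ triggeredEdges w S
        · exact mul_le_mul_of_nonneg_right (hε e he) (by positivity)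
        · have : activeProb w S (e : V × V).1 = 0 := by
            refine le_antisymm (not_lt.1 fun h => he ?_) h₀
            rwa [activeProb_eq_measureReal] at h
          simp [this]
    _ = ε * (Fintype.card V * ∑ e : E, activeProb w S (e : V × V).1) := by
        simp only [Finset.mul_sum]
    _ ≤ _ := by
        gcongr
        exact sum_activeProb_source_le w S

end Cascade

/-! ### Concentration of conditional relative frequencies -/

section Concentration

/-- The Bernstein-type moment bound for a centred Bernoulli variable, from `eˣ ≤ 1 + x + x²`. -/
lemma bernoulli_centred_exp_le {r c : ℝ} (hr₀ : 0 ≤ r) (hr₁ : r ≤ 1) (hc : |c| ≤ 1) :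
    r * Real.exp (c - (c * r + r * (1 - r) * c ^ 2))
      + (1 - r) * Real.exp (-(c * r + r * (1 - r) * c ^ 2)) ≤ 1 := by
  have quad : ∀ x : ℝ, |x| ≤ 1 → Real.exp x ≤ 1 + x + x ^ 2 := fun x hx => by
    linarith [(abs_le.1 (Real.abs_exp_sub_one_sub_id_le hx)).2]
  have h₁ := quad (c * (1 - r)) (by
    rw [abs_mul, abs_of_nonneg (sub_nonneg.2 hr₁)]
    exact mul_le_one₀ hc (sub_nonneg.2 hr₁) (by linarith))
  have h₂ := quad (-(c * r)) (by
    rw [abs_neg, abs_mul, abs_of_nonneg hr₀]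
    exact mul_le_one₀ hc hr₀ hr₁)
  have h₃ := Real.add_one_le_exp (r * (1 - r) * c ^ 2)
  have e₁ : Real.exp (c - (c * r + r * (1 - r) * c ^ 2))
      = Real.exp (c * (1 - r)) / Real.exp (r * (1 - r) * c ^ 2) := by
    rw [← Real.exp_sub]
    ring_nf
  have e₂ : Real.exp (-(c * r + r * (1 - r) * c ^ 2))
      = Real.exp (-(c * r)) / Real.exp (r * (1 - r) * c ^ 2) := by
    rw [← Real.exp_sub]
    ring_nf
  rw [e₁, e₂, mul_div_assoc', mul_div_assoc', ← add_div, div_le_one (Real.exp_pos _)]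
  have h₄ := mul_le_mul_of_nonneg_left h₁ hr₀
  have h₅ := mul_le_mul_of_nonneg_left h₂ (sub_nonneg.2 hr₁)
  linarith

variable {Ω : Type*} [MeasurableSpace Ω] [Finite Ω] [MeasurableSingletonClass Ω]

open Classical in
/-- The number of the points `x t` that lie in `A`. -/
noncomputable def hits {n : ℕ} (A : Set Ω) (x : Fin n → Ω) : ℕ :=
  (Finset.univ.filter fun t => x t ∈ A).card

/-- A Chernoff bound for the number of hits of `B` among exactly `m` hits of `A ⊇ B`, where `r` is
the conditional probability of `B` given `A`. No conditioning on the hits of `A` is needed: the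
exponential moment of `1_A (c (1_B - r) - r (1 - r) c²)` is at most `1`. -/
lemma measureReal_hits_le (μ : Measure Ω) [IsProbabilityMeasure μ] {A B : Set Ω} (hBA : B ⊆ A)
    {r : ℝ} (hr₀ : 0 ≤ r) (hr₁ : r ≤ 1) (hB : μ.real B = r * μ.real A) (n m : ℕ) {c L : ℝ}
    (hc : |c| ≤ 1) :
    (Measure.pi fun _ : Fin n => μ).real {x | hits A x = m ∧
      m * (r * (1 - r) * c ^ 2) + L ≤ c * (hits B x - r * m)} ≤ Real.exp (-L) := by
  classical
  set d : ℝ := c * r + r * (1 - r) * c ^ 2 with hd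
  set Z : Ω → ℝ := fun ω => Real.exp (c * B.indicator 1 ω - d * A.indicator 1 ω) with hZ
  have hZ_eq : ∀ ω, Z ω = 1 + (Real.exp (c - d) - Real.exp (-d)) * B.indicator 1 ω
      + (Real.exp (-d) - 1) * A.indicator 1 ω := by
    intro ω
    by_cases hωB : ω ∈ B
    · simp only [hZ, hωB, hBA hωB, Set.indicator_of_mem, Pi.one_apply, mul_one]
      ring
    · by_cases hωA : ω ∈ A <;> simp [hZ, hωB, hωA]
  have hEZ : ∫ ω, Z ω ∂μ ≤ 1 := by
    simp only [hZ_eq]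
    rw [integral_add .of_finite .of_finite, integral_add .of_finite .of_finite,
      integral_const_mul, integral_const_mul, integral_indicator_one (Set.toFinite _).measurableSet,
      integral_indicator_one (Set.toFinite _).measurableSet, hB]
    have h := bernoulli_centred_exp_le hr₀ hr₁ hc
    rw [← hd] at h
    have h' := mul_le_mul_of_nonneg_left h (measureReal_nonneg (μ := μ) (s := A))
    simp only [integral_const, probReal_univ, smul_eq_mul, mul_one]
    linarith
  have hprod : ∀ x : Fin n → Ω, ∏ t, Z (x t) = Real.exp (c * hits B x - d * hits A x) := by
    intro x
    rw [← Real.exp_sum, Finset.sum_sub_distrib, ← Finset.mul_sum, ← Finset.mul_sum]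
    simp [hits, Set.indicator_apply]
  have hint : ∫ x : Fin n → Ω, ∏ t, Z (x t) ∂(Measure.pi fun _ => μ) ≤ 1 := by
    rw [integral_fintype_prod_eq_pow (𝕜 := ℝ) Z]
    exact pow_le_one₀ (integral_nonneg fun ω => (Real.exp_pos _).le) hEZ
  have hmarkov := mul_meas_ge_le_integral_of_nonneg (μ := Measure.pi fun _ : Fin n => μ)
    (f := fun x => ∏ t, Z (x t))
    (.of_forall fun x => Finset.prod_nonneg fun t _ => (Real.exp_pos _).le) .of_finite
    (Real.exp L)
  have hsub : {x : Fin n → Ω | hits A x = m ∧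
      m * (r * (1 - r) * c ^ 2) + L ≤ c * (hits B x - r * m)}
        ⊆ {x | Real.exp L ≤ ∏ t, Z (x t)} := by
    rintro x ⟨hA, hx⟩
    simp only [Set.mem_ofPred_eq]
    rw [hprod, Real.exp_le_exp, hA, hd]
    linarith
  refine (measureReal_mono hsub).trans ?_
  rw [Real.exp_neg, ← one_div, le_div_iff₀' (Real.exp_pos L)]
  exact hmarkov.trans hint

/-- `m̂` lies within the Bernstein radius `2 √(m (1 - m) l) + l` of the Bernoulli mean `m`; here `l`
is the logarithmic factor divided by the number of observations. -/
def BernsteinClose (mhat m l : ℝ) : Prop := |mhat - m| ≤ 2 * √(m * (1 - m) * l) + l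

/-- The optimal Chernoff parameter, truncated at `1`, yields the Bernstein radius. -/
lemma exists_chernoff_parameter {v l : ℝ} (hv : 0 ≤ v) (hl : 0 < l) :
    ∃ c : ℝ, 0 ≤ c ∧ c ≤ 1 ∧ v * c ^ 2 + l ≤ c * (2 * √(v * l) + l) := by
  rcases le_total v l with h | h
  · refine ⟨1, zero_le_one, le_rfl, ?_⟩
    have : v ≤ √(v * l) := Real.le_sqrt_of_sq_le (by nlinarith)
    nlinarith [Real.sqrt_nonneg (v * l)]
  · have hv₀ : 0 < v := hl.trans_le h
    refine ⟨√(l / v), Real.sqrt_nonneg _, Real.sqrt_le_one.2 ((div_le_one hv₀).2 h), ?_⟩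
    have e₁ : √(l / v) ^ 2 = l / v := Real.sq_sqrt (by positivity)
    have e₂ : √(l / v) * √(v * l) = l := by
      rw [← Real.sqrt_mul (by positivity), show l / v * (v * l) = l ^ 2 by field_simp,
        Real.sqrt_sq hl.le]
    rw [e₁, mul_div_cancel₀ _ hv₀.ne', mul_add, mul_left_comm, e₂]
    nlinarith [mul_nonneg (Real.sqrt_nonneg (l / v)) hl.le]

/-- With `r` the conditional probability of `B` given `A`, the relative frequency of `B` among the
hits of `A` is `BernsteinClose` to `r`, for a prescribed number `m` of hits of `A`. -/
lemma measureReal_not_bernsteinClose_le (μ : Measure Ω) [IsProbabilityMeasure μ] {A B : Set Ω}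
    (hBA : B ⊆ A) {r : ℝ} (hr₀ : 0 ≤ r) (hr₁ : r ≤ 1) (hB : μ.real B = r * μ.real A) (n : ℕ)
    {m : ℕ} (hm : 0 < m) {L : ℝ} (hL : 0 < L) :
    (Measure.pi fun _ : Fin n => μ).real {x | hits A x = m ∧
      ¬ BernsteinClose ((hits B x : ℝ) / m) r (L / m)} ≤ 2 * Real.exp (-L) := by
  have hm' : (0 : ℝ) < m := Nat.cast_pos.2 hm
  obtain ⟨c, hc₀, hc₁, hc⟩ := exists_chernoff_parameter
    (mul_nonneg hr₀ (sub_nonneg.2 hr₁)) (div_pos hL hm')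
  have hup := measureReal_hits_le μ hBA hr₀ hr₁ hB n m (c := c) (L := L)
    (by rwa [abs_of_nonneg hc₀])
  have hlo := measureReal_hits_le μ hBA hr₀ hr₁ hB n m (c := -c) (L := L)
    (by rwa [abs_neg, abs_of_nonneg hc₀])
  rw [two_mul]
  refine (measureReal_mono ?_).trans ((measureReal_union_le _ _).trans (add_le_add hup hlo))
  rintro x ⟨hA, hx⟩
  rw [BernsteinClose, not_le] at hx
  have hkey : m * (r * (1 - r) * c ^ 2) + L ≤ m * (c * |(hits B x : ℝ) / m - r|) := by
    calc m * (r * (1 - r) * c ^ 2) + L = m * (r * (1 - r) * c ^ 2 + L / m) := by field_simp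
      _ ≤ m * (c * (2 * √(r * (1 - r) * (L / m)) + L / m)) := by gcongr
      _ ≤ _ := by gcongr
  rcases abs_cases ((hits B x : ℝ) / m - r) with ⟨h, -⟩ | ⟨h, -⟩
  · refine .inl ⟨hA, hkey.trans_eq ?_⟩
    rw [h]
    field_simp
  · refine .inr ⟨hA, ?_⟩
    rw [neg_sq]
    refine hkey.trans_eq ?_
    rw [h]
    field_simp

end Concentration

/-! ### Confidence radii -/

section Radius

lemma BernsteinClose.abs_sub_le_radius {mhat m L N : ℝ} (hl : 0 ≤ L / N) (hm₀ : 0 ≤ m) (hm₁ : m ≤ 1)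
    (hmhat₀ : 0 ≤ mhat) (hmhat₁ : mhat ≤ 1) (h : BernsteinClose mhat m (L / N)) :
    |mhat - m| ≤ radius L mhat N := by
  rw [BernsteinClose] at h
  set D := |mhat - m| with hD
  rw [radius, mul_div_assoc, mul_div_assoc]
  set l := L / N
  have hD₀ : 0 ≤ D := abs_nonneg _
  by_contra! hlt
  have hs := Real.sqrt_nonneg (6 * (1 - mhat) * mhat * l)
  have hDl : 9 * l < D := by linarith
  -- the true variance exceeds the empirical one by at most `D`
  have hvar : m * (1 - m) ≤ (1 - mhat) * mhat + D := by
    have h₁ := neg_abs_le (mhat - m)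
    have h₂ := le_abs_self (mhat - m)
    rcases le_total 0 (mhat - m) with h | h
    · rw [abs_of_nonneg h] at hD
      nlinarith
    · rw [abs_of_nonpos h] at hD
      nlinarith
  have h₁ : (D - l) ^ 2 ≤ 4 * (m * (1 - m) * l) := by
    have : (D - l) ^ 2 ≤ (2 * √(m * (1 - m) * l)) ^ 2 :=
      pow_le_pow_left₀ (by linarith) (by linarith) 2
    rwa [mul_pow, Real.sq_sqrt (mul_nonneg (mul_nonneg hm₀ (by linarith)) hl), show (2 : ℝ) ^ 2 = 4 by
      norm_num] at this
  have h₂ : 6 * (1 - mhat) * mhat * l < (D - 9 * l) ^ 2 := by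
    have h0 : 0 ≤ 6 * (1 - mhat) * mhat * l :=
      mul_nonneg (mul_nonneg (by linarith) hmhat₀) hl
    have := pow_lt_pow_left₀ (show √(6 * (1 - mhat) * mhat * l) < D - 9 * l by linarith) hs two_ne_zero
    rwa [Real.sq_sqrt h0] at this
  have h₃ := mul_le_mul_of_nonneg_right hvar hl
  have h₄ : 0 ≤ (1 - mhat) * mhat * l := mul_nonneg (mul_nonneg (by linarith) hmhat₀) hl
  nlinarith [mul_nonneg hD₀ hl, mul_nonneg hl hl, mul_nonneg hl (sub_nonneg.2 hDl.le)]

/-- Once there are enough observations, relative to the mean `m`, the confidence bounds are within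
`6 √(m l)` of `m`. -/
lemma BernsteinClose.abs_sub_add_radius_le {mhat m L N : ℝ} (hl : 0 ≤ L / N)
    (hmhat₀ : 0 ≤ mhat) (hlm : 256 * (L / N) ≤ m)
    (h : BernsteinClose mhat m (L / N)) :
    |mhat - m| + radius L mhat N ≤ 6 * √(m * (L / N)) := by
  rw [BernsteinClose] at h
  rw [radius, mul_div_assoc, mul_div_assoc]
  set l := L / N
  have hm₀ : 0 ≤ m := by linarith
  set s := √(m * l) with hs
  have hs₀ : 0 ≤ s := Real.sqrt_nonneg _
  have hls : 16 * l ≤ s := Real.le_sqrt_of_sq_le (by nlinarith)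
  have hsm : 16 * s ≤ m := by
    have : s ≤ m / 16 := Real.sqrt_le_iff.2 ⟨by positivity, by nlinarith⟩
    linarith
  have hvs : √(m * (1 - m) * l) ≤ s := Real.sqrt_le_sqrt (by nlinarith [mul_nonneg hm₀ hl])
  have hmhat : mhat ≤ (1 + 9 / 64) * m := by
    have := le_abs_self (mhat - m)
    linarith
  have hrad : √(6 * (1 - mhat) * mhat * l) ≤ 3 * s := by
    refine Real.sqrt_le_iff.2 ⟨by positivity, ?_⟩
    rw [mul_pow, hs, Real.sq_sqrt (mul_nonneg hm₀ hl)]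
    nlinarith [mul_nonneg hm₀ hl, mul_nonneg (mul_nonneg hmhat₀ hmhat₀) hl,
      mul_le_mul_of_nonneg_right hmhat hl]
  linarith

end Radius

/-! ### One step of the observed cascade -/

section OneStep

variable {V : Type*} [Fintype V] [DecidableEq V] {E : Finset (V × V)}

lemma mem_observe_zero {x : Sample E} {u : V} : u ∈ observe x 0 ↔ x.1 u = true := by
  simp [observe, cascade]

lemma notMem_observe_one {x : Sample E} {v : V} :
    v ∉ observe x 1 ↔ x.1 v = false ∧
      ∀ e : E, (e : V × V).2 = v → x.1 (e : V × V).1 = true → x.2 e = false := by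
  rw [observe, cascade, mem_icStep]
  simp only [Finset.mem_filter, Finset.mem_univ, true_and, Finset.sdiff_empty, not_or,
    Bool.not_eq_true, not_exists, not_and]
  refine and_congr_right fun _ => ⟨fun h e hev hu => ?_, fun h u hu huv => h ⟨(u, v), huv⟩ rfl hu⟩
  subst hev
  exact h _ hu e.2

/-- No seed other than possibly the source of `e` prevents the target of `e` from being inactive
after one step: the target is no seed and no other edge into it fires. -/
def InactiveApartFrom (e : E) (s : V → Bool) (c : E → Bool) : Prop :=
  s (e : V × V).2 = false ∧
    ∀ e' : E, e' ≠ e → (e' : V × V).2 = (e : V × V).2 → s (e' : V × V).1 = true → c e' = false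

/-- The probability `p(v̄ | ū)` for an edge `e = (u, v)` that is no self-loop, encoded as the
probability of `InactiveApartFrom e`. This event does not depend on `u` being a seed, so the
definition is meaningful also if `u` is a seed almost surely. -/
noncomputable def condInactiveProb (q : V → I) (p : E → I) (e : E) : ℝ :=
  (sampleMeasure q p).real {x | InactiveApartFrom e x.1 x.2}

variable {e : E}

omit [Fintype V] in
lemma inactiveApartFrom_update_seed (he : (e : V × V).1 ≠ (e : V × V).2) (s : V → Bool)
    (c : E → Bool) (b : Bool) :
    InactiveApartFrom e (Function.update s (e : V × V).1 b) c ↔ InactiveApartFrom e s c := by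
  rw [InactiveApartFrom, InactiveApartFrom, Function.update_of_ne he.symm]
  refine and_congr_right fun _ => forall₃_congr fun e' hne h₂ => ?_
  rw [Function.update_of_ne fun h₁ => hne (Subtype.ext (Prod.ext h₁ h₂))]

omit [Fintype V] in
lemma inactiveApartFrom_update_coin (s : V → Bool) (c : E → Bool) (b : Bool) :
    InactiveApartFrom e s (Function.update c e b) ↔ InactiveApartFrom e s c := by
  refine and_congr_right fun _ => forall₂_congr fun e' hne => ?_
  rw [Function.update_of_ne hne]

lemma notMem_observe_one_target_iff {x : Sample E} :
    (e : V × V).2 ∉ observe x 1 ↔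
      InactiveApartFrom e x.1 x.2 ∧ (x.1 (e : V × V).1 = true → x.2 e = false) := by
  rw [notMem_observe_one, InactiveApartFrom, and_assoc]
  refine and_congr_right fun _ => ⟨fun h => ⟨fun e' _ => h e', h e rfl⟩, fun h e' => ?_⟩
  rcases eq_or_ne e' e with rfl | hne
  · exact fun _ => h.2
  · exact h.1 e' hne

omit [DecidableEq V] in
open Classical in
lemma sampleMeasure_real_eq (q : V → I) (p : E → I) (A : Set (Sample E)) :
    (sampleMeasure q p).real A
      = ∫ s, ∫ c, (if (s, c) ∈ A then 1 else 0) ∂(tossMeasure p) ∂(tossMeasure q) := by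
  rw [← integral_indicator_one .of_discrete, sampleMeasure, integral_prod _ .of_finite]
  simp only [Set.indicator_apply, Pi.one_apply]

lemma sampleMeasure_real_notSeed (q : V → I) (p : E → I) (u : V) :
    (sampleMeasure q p).real {x | u ∉ observe x 0} = 1 - q u := by
  classical
  rw [sampleMeasure_real_eq, integral_tossMeasure_split q u]
  simp [mem_observe_zero]

lemma sampleMeasure_real_seed (q : V → I) (p : E → I) (u : V) :
    (sampleMeasure q p).real {x | u ∈ observe x 0} = q u := by
  classical
  rw [sampleMeasure_real_eq, integral_tossMeasure_split q u]
  simp [mem_observe_zero]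

lemma sampleMeasure_real_notSeed_inactive (q : V → I) (p : E → I)
    (he : (e : V × V).1 ≠ (e : V × V).2) :
    (sampleMeasure q p).real {x | (e : V × V).1 ∉ observe x 0 ∧ (e : V × V).2 ∉ observe x 1}
      = condInactiveProb q p e
        * (sampleMeasure q p).real {x | (e : V × V).1 ∉ observe x 0} := by
  classical
  rw [sampleMeasure_real_notSeed, condInactiveProb, sampleMeasure_real_eq, sampleMeasure_real_eq,
    integral_tossMeasure_split q (e : V × V).1]
  simp [mem_observe_zero, notMem_observe_one_target_iff, inactiveApartFrom_update_seed he]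
  ring

/-- The identity behind the estimator: `p(v̄) = p(v̄ | ū) (1 - q_u p_{uv})`. -/
lemma probInactive_eq (q : V → I) (p : E → I) (he : (e : V × V).1 ≠ (e : V × V).2) :
    probInactive q p (e : V × V).2
      = condInactiveProb q p e * (1 - q (e : V × V).1 * p e) := by
  classical
  have hcoin : ∀ s : V → Bool,
      ∫ c, (if InactiveApartFrom e s c ∧ c e = false then (1 : ℝ) else 0) ∂(tossMeasure p)
        = (1 - p e) * ∫ c, (if InactiveApartFrom e s c then (1 : ℝ) else 0) ∂(tossMeasure p) := by
    intro s
    rw [integral_tossMeasure_split p e]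
    simp [inactiveApartFrom_update_coin]
  rw [probInactive, condInactiveProb, sampleMeasure_real_eq, sampleMeasure_real_eq,
    integral_tossMeasure_split q (e : V × V).1]
  simp only [Set.mem_ofPred_eq, notMem_observe_one_target_iff, inactiveApartFrom_update_seed he,
    Function.update_self, true_implies, hcoin, integral_const_mul, Bool.false_eq_true,
    false_implies, and_true]
  ring

lemma probInactive_nonneg (q : V → I) (p : E → I) (v : V) : 0 ≤ probInactive q p v :=
  measureReal_nonneg

lemma probInactive_le_one (q : V → I) (p : E → I) (v : V) : probInactive q p v ≤ 1 :=
  measureReal_le_one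

omit [DecidableEq V] in
lemma condInactiveProb_nonneg (q : V → I) (p : E → I) (e : E) : 0 ≤ condInactiveProb q p e :=
  measureReal_nonneg

omit [DecidableEq V] in
lemma condInactiveProb_le_one (q : V → I) (p : E → I) (e : E) : condInactiveProb q p e ≤ 1 :=
  measureReal_le_one

/-! ### The good event -/

variable {n : ℕ}

/-- All relative frequencies used by the algorithm are `BernsteinClose` to their means. The
conditional frequency is only considered for edges that are not self-loops. -/
structure GoodData (q : V → I) (p : E → I) (L : ℝ) (D : Fin n → ℕ → Finset V) : Prop where
  seed (e : E) : BernsteinClose ((cntSeed D (e : V × V).1 : ℝ) / n) (q (e : V × V).1) (L / n)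
  inactive (e : E) : BernsteinClose ((cntInactive D (e : V × V).2 : ℝ) / n)
    (probInactive q p (e : V × V).2) (L / n)
  cond (e : E) (he : (e : V × V).1 ≠ (e : V × V).2) (hN : cntNotSeed D (e : V × V).1 ≠ 0) :
    BernsteinClose ((cntNotSeedInactive D (e : V × V).1 (e : V × V).2 : ℝ)
        / cntNotSeed D (e : V × V).1)
      (condInactiveProb q p e) (L / cntNotSeed D (e : V × V).1)

omit [Fintype V] in
lemma cntSeed_add_cntNotSeed (D : Fin n → ℕ → Finset V) (u : V) :
    cntSeed D u + cntNotSeed D u = n := by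
  simpa [cntSeed, cntNotSeed] using
    Finset.card_filter_add_card_filter_not (s := Finset.univ) (fun t : Fin n => u ∈ D t 0)

omit [Fintype V] in
lemma cntNotSeedInactive_le (D : Fin n → ℕ → Finset V) (u v : V) :
    cntNotSeedInactive D u v ≤ cntNotSeed D u :=
  Finset.card_le_card fun t => by simp +contextual

omit [Fintype V] in
lemma cntInactive_le (D : Fin n → ℕ → Finset V) (v : V) : cntInactive D v ≤ n := by
  simpa [cntInactive] using
    Finset.card_filter_le (Finset.univ : Finset (Fin n)) fun t => v ∉ D t 1

/-- The union bound over the edges and over the possible values of `n_{0,ū}`. -/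
lemma measureReal_not_goodData_le (q : V → I) (p : E → I) (hn : 1 ≤ n) {L : ℝ} (hL : 0 < L) :
    (dataMeasure n q p).real {x | ¬ GoodData q p L (dataset x)}
      ≤ 6 * n * E.card * Real.exp (-L) := by
  set μ := sampleMeasure q p with hμ
  have hdata : dataMeasure n q p = Measure.pi fun _ : Fin n => μ := rfl
  set bad : E → Set (Fin n → Sample E) := fun e =>
    ({x | ¬ BernsteinClose ((cntSeed (dataset x) (e : V × V).1 : ℝ) / n) (q (e : V × V).1) (L / n)} ∪
      {x | ¬ BernsteinClose ((cntInactive (dataset x) (e : V × V).2 : ℝ) / n)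
        (probInactive q p (e : V × V).2) (L / n)}) ∪
      ⋃ m ∈ Finset.range n, {x | (e : V × V).1 ≠ (e : V × V).2 ∧
        cntNotSeed (dataset x) (e : V × V).1 = m + 1 ∧
          ¬ BernsteinClose ((cntNotSeedInactive (dataset x) (e : V × V).1 (e : V × V).2 : ℝ)
            / (m + 1 : ℕ)) (condInactiveProb q p e) (L / (m + 1 : ℕ))} with hbad
  have hsub : {x : Fin n → Sample E | ¬ GoodData q p L (dataset x)} ⊆ ⋃ e ∈ Finset.univ, bad e := by
    intro x hx
    by_contra hx'
    simp only [hbad, Set.mem_iUnion, Set.mem_union, Set.mem_ofPred_eq, not_exists, not_or,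
      Finset.mem_univ, Finset.mem_range, true_implies, not_not, not_and] at hx'
    refine hx ⟨fun e => (hx' e).1.1, fun e => (hx' e).1.2, fun e he hN => ?_⟩
    obtain ⟨m, hm⟩ := Nat.exists_eq_succ_of_ne_zero hN
    have hle := cntSeed_add_cntNotSeed (dataset x) (e : V × V).1
    have := (hx' e).2 m (by omega) he hm
    rw [hm]
    exact this
  have huniv : ∀ x : Fin n → Sample E, hits Set.univ x = n := fun x => by simp [hits]
  have hQ : ∀ e : E, (dataMeasure n q p).real {x | ¬ BernsteinClose
      ((cntSeed (dataset x) (e : V × V).1 : ℝ) / n) (q (e : V × V).1) (L / n)}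
        ≤ 2 * Real.exp (-L) := fun e => by
    refine le_trans (le_of_eq ?_) (measureReal_not_bernsteinClose_le μ
      (A := Set.univ) (B := {x | (e : V × V).1 ∈ observe x 0}) (Set.subset_univ _)
      (q (e : V × V).1).2.1 (q (e : V × V).1).2.2 (by simp [hμ, sampleMeasure_real_seed]) n hn hL)
    rw [hdata]
    congr 1
    ext x
    simp only [Set.mem_ofPred_eq, huniv, true_and]
    simp only [hits, cntSeed, dataset, Set.mem_ofPred_eq]
    congr!
  have hP : ∀ e : E, (dataMeasure n q p).real {x | ¬ BernsteinClose
      ((cntInactive (dataset x) (e : V × V).2 : ℝ) / n) (probInactive q p (e : V × V).2) (L / n)}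
        ≤ 2 * Real.exp (-L) := fun e => by
    refine le_trans (le_of_eq ?_) (measureReal_not_bernsteinClose_le μ
      (A := Set.univ) (B := {x | (e : V × V).2 ∉ observe x 1}) (Set.subset_univ _)
      (probInactive_nonneg q p (e : V × V).2) (probInactive_le_one q p _)
      (by simp [hμ, probInactive]) n hn hL)
    rw [hdata]
    congr 1
    ext x
    simp only [Set.mem_ofPred_eq, huniv, true_and]
    simp only [hits, cntInactive, dataset, Set.mem_ofPred_eq]
    congr!
  have hR : ∀ e : E, ∀ m ∈ Finset.range n,
      (dataMeasure n q p).real {x | (e : V × V).1 ≠ (e : V × V).2 ∧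
        cntNotSeed (dataset x) (e : V × V).1 = m + 1 ∧
          ¬ BernsteinClose ((cntNotSeedInactive (dataset x) (e : V × V).1 (e : V × V).2 : ℝ)
            / (m + 1 : ℕ)) (condInactiveProb q p e) (L / (m + 1 : ℕ))}
        ≤ 2 * Real.exp (-L) := fun e m _ => by
    by_cases he : (e : V × V).1 ≠ (e : V × V).2
    · refine le_trans (le_of_eq ?_) (measureReal_not_bernsteinClose_le μ
        (A := {x | (e : V × V).1 ∉ observe x 0})
        (B := {x | (e : V × V).1 ∉ observe x 0 ∧ (e : V × V).2 ∉ observe x 1})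
        (fun x hx => hx.1) (condInactiveProb_nonneg q p e) (condInactiveProb_le_one q p e)
        (sampleMeasure_real_notSeed_inactive q p he) n m.succ_pos hL)
      rw [hdata]
      congr 1
      ext x
      simp only [Set.mem_ofPred_eq, ne_eq, he, not_false_eq_true, true_and]
      simp only [hits, cntNotSeed, cntNotSeedInactive, dataset, Set.mem_ofPred_eq,
        Nat.succ_eq_add_one]
      congr!
    · simp only [he, false_and, Set.ofPred_false, measureReal_empty]
      positivity
  have hn' : (1 : ℝ) ≤ n := Nat.one_le_cast.2 hn
  calc (dataMeasure n q p).real {x | ¬ GoodData q p L (dataset x)}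
      ≤ (dataMeasure n q p).real (⋃ e ∈ Finset.univ, bad e) := by
        rw [hdata]
        exact measureReal_mono hsub (measure_ne_top _ _)
    _ ≤ ∑ e : E, (dataMeasure n q p).real (bad e) := measureReal_biUnion_finset_le _ _
    _ ≤ ∑ e : E, 6 * n * Real.exp (-L) := by
        refine Finset.sum_le_sum fun e _ => ?_
        have hcond := (measureReal_biUnion_finset_le (μ := dataMeasure n q p) (Finset.range n) _).trans
          (Finset.sum_le_sum (hR e))
        rw [Finset.sum_const, Finset.card_range, nsmul_eq_mul] at hcond
        have h := (measureReal_union_le (μ := dataMeasure n q p) _ _).trans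
          (add_le_add ((measureReal_union_le _ _).trans (add_le_add (hQ e) (hP e))) hcond)
        refine h.trans ?_
        nlinarith [Real.exp_pos (-L)]
    _ = 6 * n * E.card * Real.exp (-L) := by
        rw [Finset.sum_const, Finset.card_univ, Fintype.card_coe, nsmul_eq_mul]
        ring

end OneStep

/-! ### The lower confidence bounds on the edge probabilities -/

/-- If the bounds on `q`, `P = r (1 - q p)` and `r` hold, then the plug-in value is a lower bound
for `p`. -/
lemma plugin_le {qb Pb rl q P r p : ℝ} (hqb : 0 < qb) (hrl : 0 < rl) (hP₀ : 0 ≤ P) (hp₀ : 0 ≤ p)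
    (hP : P = r * (1 - q * p)) (hq : q ≤ qb) (hPb : P ≤ Pb) (hr : rl ≤ r) :
    1 / qb * (1 - Pb / rl) ≤ p := by
  have h : 1 - q * p ≤ Pb / rl := by
    have hr₀ : 0 < r := hrl.trans_le hr
    calc 1 - q * p = P / r := by rw [hP, mul_div_cancel_left₀ _ hr₀.ne']
      _ ≤ Pb / rl := div_le_div₀ (hP₀.trans hPb) hPb hrl hr
  rw [one_div, inv_mul_le_iff₀ hqb]
  nlinarith

/-- If the bounds are off by relative errors of order `t`, the plug-in value is off by at most
`42 t / γ`. -/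
lemma sub_plugin_le {qb Pb rl q P r p γ t : ℝ} (hγ : 0 < γ) (hr₀ : 0 < r) (hγq : γ ≤ q)
    (hq₁ : q ≤ 1) (hp₀ : 0 ≤ p) (hp₁ : p ≤ 1) (ht : 0 ≤ t) (hP : P = r * (1 - q * p))
    (hq : q ≤ qb) (hqb : qb ≤ q * (1 + 6 * t)) (hPb : Pb ≤ P + 6 * (r * t))
    (hrl : r * (1 - 12 * t) ≤ rl) (hrl' : r / 2 ≤ rl) :
    p - 1 / qb * (1 - Pb / rl) ≤ 42 * (t / γ) := by
  have hqb₀ : 0 < qb := hγ.trans_le (hγq.trans hq)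
  have hrl₀ : 0 < rl := by linarith
  have hqp₀ : 0 ≤ q * p := mul_nonneg (hγ.le.trans hγq) hp₀
  have hqp₁ : q * p ≤ 1 := mul_le_one₀ hq₁ hp₀ hp₁
  have h₁ : Pb / rl ≤ 1 - q * p + 36 * t := by
    rw [div_le_iff₀ hrl₀]
    have e₁ := mul_le_mul_of_nonneg_left hrl (sub_nonneg.2 hqp₁)
    have e₂ := mul_le_mul_of_nonneg_left hrl' ht
    have e₃ : 0 ≤ r * t * (q * p) := mul_nonneg (mul_nonneg hr₀.le ht) hqp₀
    nlinarith
  have h₂ : p * qb ≤ q * p + 6 * t := by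
    have e₁ := mul_le_mul_of_nonneg_left hqb hp₀
    have e₂ := mul_le_mul_of_nonneg_right hqp₁ ht
    nlinarith
  calc p - 1 / qb * (1 - Pb / rl) = (p * qb - (1 - Pb / rl)) / qb := by field_simp
    _ ≤ 42 * t / qb := by gcongr; linarith
    _ ≤ 42 * t / γ := by gcongr; exact hγq.trans hq
    _ = _ := by ring

section EdgeLCB

variable {V : Type*} [Fintype V] [DecidableEq V] {E : Finset (V × V)} {n : ℕ}
  {q : V → I} {p : E → I} {L : ℝ} {D : Fin n → ℕ → Finset V}

lemma radius_pos {L m N : ℝ} (hL : 0 < L) (hN : 0 < N) : 0 < radius L m N := by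
  unfold radius
  positivity

omit [Fintype V] in
lemma ucbSeed_pos (hL : 0 < L) (hn : 1 ≤ n) (D : Fin n → ℕ → Finset V) (u : V) :
    0 < ucbSeed D L u :=
  lt_min (add_pos_of_nonneg_of_pos (by positivity) (radius_pos hL (Nat.cast_pos.2 hn))) one_pos

omit [Fintype V] in
lemma lcbCondInactive_nonneg (D : Fin n → ℕ → Finset V) (L : ℝ) (u v : V) :
    0 ≤ lcbCondInactive D L u v := by
  unfold lcbCondInactive
  split_ifs
  exacts [le_rfl, le_max_right _ _]

namespace GoodData

variable (h : GoodData q p L D) (hL : 0 < L) (hn : 1 ≤ n) (e : E)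
include h hL hn

lemma le_ucbSeed : (q (e : V × V).1 : ℝ) ≤ ucbSeed D L (e : V × V).1 := by
  refine le_min ?_ (q _).2.2
  have hcnt := cntSeed_add_cntNotSeed D (e : V × V).1
  have := (h.seed e).abs_sub_le_radius (by positivity) (q _).2.1 (q _).2.2 (by positivity)
    (div_le_one_of_le₀ (Nat.cast_le.2 (by omega)) (Nat.cast_nonneg _))
  linarith [neg_abs_le ((cntSeed D (e : V × V).1 : ℝ) / n - q (e : V × V).1)]

lemma le_ucbInactive : probInactive q p (e : V × V).2 ≤ ucbInactive D L (e : V × V).2 := by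
  refine le_min ?_ (probInactive_le_one q p _)
  have := (h.inactive e).abs_sub_le_radius (by positivity) (probInactive_nonneg q p _)
    (probInactive_le_one q p _) (by positivity)
    (div_le_one_of_le₀ (Nat.cast_le.2 (cntInactive_le D _)) (Nat.cast_nonneg _))
  linarith [neg_abs_le ((cntInactive D (e : V × V).2 : ℝ) / n - probInactive q p (e : V × V).2)]

omit hn in
lemma lcbCondInactive_le (he : (e : V × V).1 ≠ (e : V × V).2) :
    lcbCondInactive D L (e : V × V).1 (e : V × V).2 ≤ condInactiveProb q p e := by
  unfold lcbCondInactive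
  split_ifs with hN
  · exact condInactiveProb_nonneg q p e
  · refine max_le ?_ (condInactiveProb_nonneg q p e)
    have := (h.cond e he hN).abs_sub_le_radius (by positivity) (condInactiveProb_nonneg q p e)
      (condInactiveProb_le_one q p e) (by positivity)
      (div_le_one_of_le₀ (Nat.cast_le.2 (cntNotSeedInactive_le D _ _)) (Nat.cast_nonneg _))
    linarith [le_abs_self ((cntNotSeedInactive D (e : V × V).1 (e : V × V).2 : ℝ)
      / cntNotSeed D (e : V × V).1 - condInactiveProb q p e)]

/-- `edgeLCB` is a lower bound for the edge probability, except possibly at self-loops. -/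
lemma edgeLCB_le (he : (e : V × V).1 ≠ (e : V × V).2) : edgeLCB D L (e : V × V) ≤ p e := by
  unfold edgeLCB
  split_ifs with h₀
  · exact unitInterval.nonneg'
  · refine (min_le_right _ _).trans (max_le (p e).2.1 ?_)
    exact plugin_le (ucbSeed_pos hL hn D _)
      ((lcbCondInactive_nonneg D L _ _).lt_of_ne (Ne.symm h₀)) (probInactive_nonneg q p _) (p e).2.1
      (probInactive_eq q p he) (h.le_ucbSeed hL hn e) (h.le_ucbInactive hL hn e)
      (h.lcbCondInactive_le hL e he)

/-- There are enough cascades in which a given node is no seed. -/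
lemma le_cntNotSeed {γ : ℝ} (hγ : 0 < γ) (hqγ : (q (e : V × V).1 : ℝ) ≤ 1 - γ)
    (hln : 392 * (L / n) ≤ γ) : 4 / 5 * γ * n ≤ cntNotSeed D (e : V × V).1 := by
  have hclose := h.seed e
  rw [BernsteinClose] at hclose
  have hn' : (0 : ℝ) < n := Nat.cast_pos.2 hn
  have hl : 0 ≤ L / n := by positivity
  have hq₀ := (q (e : V × V).1).2.1
  have hs : √(q (e : V × V).1 * (1 - q (e : V × V).1) * (L / n)) ≤ (1 - q (e : V × V).1) / 19 := by
    refine Real.sqrt_le_iff.2 ⟨by linarith, ?_⟩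
    nlinarith [mul_nonneg (show (0 : ℝ) ≤ 1 - q (e : V × V).1 by linarith) hl]
  have hcnt : (cntSeed D (e : V × V).1 : ℝ) + cntNotSeed D (e : V × V).1 = n := by
    exact_mod_cast cntSeed_add_cntNotSeed D (e : V × V).1
  have hup := (le_abs_self _).trans hclose
  have hfrac : 4 / 5 * γ ≤ 1 - (cntSeed D (e : V × V).1 : ℝ) / n := by linarith
  have e₁ : (cntNotSeed D (e : V × V).1 : ℝ) = (1 - (cntSeed D (e : V × V).1 : ℝ) / n) * n := by
    field_simp
    linarith
  rw [e₁]
  exact mul_le_mul_of_nonneg_right hfrac hn'.le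

/-- The accuracy of `edgeLCB` at an edge with good coverage. -/
lemma sub_edgeLCB_le (he : (e : V × V).1 ≠ (e : V × V).2) {η γ : ℝ} (hη₀ : 0 < η) (hη₁ : η ≤ 1)
    (hγ : 0 < γ) (hq : (q (e : V × V).1 : ℝ) ∈ Set.Icc γ (1 - γ))
    (hη : η ≤ probInactive q p (e : V × V).2) (hln : 392 * (L / n) ≤ η * γ) :
    (p e : ℝ) - edgeLCB D L (e : V × V) ≤ 42 * √(L / (η * γ ^ 3 * n)) := by
  set l := L / n with hl_def
  set u := (e : V × V).1
  set v := (e : V × V).2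
  have hn' : (0 : ℝ) < n := Nat.cast_pos.2 hn
  have hl : 0 < l := by positivity
  have hγ₁ : γ ≤ 1 := by linarith [hq.1, hq.2]
  have hηγ : 0 < η * γ := by positivity
  have hηγ_le_γ : η * γ ≤ γ := mul_le_of_le_one_left hγ.le hη₁
  have hηγ_le_η : η * γ ≤ η := mul_le_of_le_one_right hη₀.le hγ₁
  -- `t` is the common relative error of the three confidence bounds
  set t := √(l / (η * γ)) with ht_def
  have ht : 0 ≤ t := Real.sqrt_nonneg _
  have hε : √(L / (η * γ ^ 3 * n)) = t / γ := by
    rw [eq_div_iff hγ.ne', ht_def, ← Real.sqrt_sq hγ.le, ← Real.sqrt_mul (by positivity),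
      Real.sqrt_sq hγ.le, hl_def]
    congr 1
    field_simp
  set r := condInactiveProb q p e with hr_def
  have hP := probInactive_eq q p he
  have hqp : 0 ≤ (q u : ℝ) * p e := mul_nonneg (q u).2.1 (p e).2.1
  have hPr : probInactive q p v ≤ r := by
    rw [hP]
    exact mul_le_of_le_one_right (condInactiveProb_nonneg q p e) (by linarith)
  have hηr : η ≤ r := hη.trans hPr
  have hr₀ : 0 < r := hη₀.trans_le hηr
  have hsqrt : ∀ a b c : ℝ, 0 ≤ b → 0 ≤ c → a ≤ b ^ 2 * c ^ 2 * (l / (η * γ)) →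
      √a ≤ b * (c * t) := fun a b c hb hc h => by
    refine Real.sqrt_le_iff.2 ⟨by positivity, h.trans_eq ?_⟩
    rw [mul_pow, mul_pow, ht_def, Real.sq_sqrt (by positivity)]
    ring
  -- the upper bound for `q`
  have hqb : ucbSeed D L u ≤ q u * (1 + 6 * t) := by
    have h₁ := (h.seed e).abs_sub_add_radius_le hl.le (by positivity) (by linarith [hq.1])
    have h₂ : √((q u : ℝ) * l) ≤ q u * (1 * t) := by
      refine hsqrt _ _ _ (q u).2.1 zero_le_one ?_
      rw [one_pow, mul_one, ← mul_div_assoc (_ ^ 2), le_div_iff₀ hηγ, sq, mul_right_comm]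
      exact mul_le_mul_of_nonneg_right
        (mul_le_mul_of_nonneg_left (hηγ_le_γ.trans hq.1) (q u).2.1) hl.le
    have h₃ := le_abs_self ((cntSeed D u : ℝ) / n - q u)
    refine (min_le_left _ _).trans ?_
    linarith
  -- the upper bound for `p(v̄)`
  have hPb : ucbInactive D L v ≤ probInactive q p v + 6 * (r * t) := by
    have h₁ := (h.inactive e).abs_sub_add_radius_le hl.le (by positivity) (by linarith)
    have h₂ : √(probInactive q p v * l) ≤ r * (1 * t) := by
      refine hsqrt _ _ _ hr₀.le zero_le_one ?_
      rw [one_pow, mul_one, ← mul_div_assoc (_ ^ 2), le_div_iff₀ hηγ, sq, mul_right_comm]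
      exact mul_le_mul_of_nonneg_right
        (mul_le_mul hPr (hηγ_le_η.trans hηr) hηγ.le hr₀.le) hl.le
    have h₃ := le_abs_self ((cntInactive D v : ℝ) / n - probInactive q p v)
    refine (min_le_left _ _).trans ?_
    linarith
  -- the lower bound for `p(v̄ | ū)`
  have hN := h.le_cntNotSeed hL hn e hγ hq.2 (hln.trans hηγ_le_γ)
  have hN₀ : (0 : ℝ) < cntNotSeed D u := lt_of_lt_of_le (by positivity) hN
  have hl' : L / cntNotSeed D u ≤ 5 / 4 * (l / γ) := by
    calc L / cntNotSeed D u ≤ L / (4 / 5 * γ * n) := by gcongr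
      _ = 5 / 4 * (l / γ) := by rw [hl_def]; field_simp
  have hlγ : 392 * (l / γ) ≤ η := by
    rw [mul_div_assoc', div_le_iff₀ hγ]
    exact hln
  have hl'₀ : 0 ≤ L / cntNotSeed D u := by positivity
  have hN₁ : cntNotSeed D u ≠ 0 := Nat.cast_ne_zero.1 hN₀.ne'
  have hrad := (h.cond e he hN₁).abs_sub_add_radius_le hl'₀ (by positivity) (by linarith)
  have hrl_ge : r - 6 * √(r * (L / cntNotSeed D u)) ≤ lcbCondInactive D L u v := by
    rw [lcbCondInactive, if_neg hN₁]
    refine le_trans ?_ (le_max_left _ _)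
    linarith [neg_abs_le ((cntNotSeedInactive D u v : ℝ) / cntNotSeed D u - r)]
  have hrl : r * (1 - 12 * t) ≤ lcbCondInactive D L u v := by
    have h₂ : √(r * (L / cntNotSeed D u)) ≤ r * (2 * t) := by
      refine hsqrt _ _ _ hr₀.le zero_le_two ?_
      calc r * (L / cntNotSeed D u) ≤ r * (4 * (l / γ)) := by
            gcongr
            linarith [show 0 ≤ l / γ by positivity]
        _ = r * η * 2 ^ 2 * (l / (η * γ)) := by field_simp; norm_num
        _ ≤ r * r * 2 ^ 2 * (l / (η * γ)) := by gcongr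
        _ = _ := by ring
    linarith
  have hrl' : r / 2 ≤ lcbCondInactive D L u v := by
    have h₂ : √(r * (L / cntNotSeed D u)) ≤ r / 16 := by
      refine Real.sqrt_le_iff.2 ⟨by positivity, ?_⟩
      nlinarith
    linarith
  have hmain := sub_plugin_le hγ hr₀ hq.1 (q u).2.2 (p e).2.1 (p e).2.2 ht hP
    (h.le_ucbSeed hL hn e) hqb hPb hrl hrl'
  rw [hε, edgeLCB, if_neg (by linarith : lcbCondInactive D L u v ≠ 0)]
  have ht' : 0 ≤ 42 * (t / γ) := by positivity
  change (p e : ℝ) - min 1 (max 0 (1 / ucbSeed D L u *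
    (1 - ucbInactive D L v / lcbCondInactive D L u v))) ≤ _
  rw [sub_le_comm]
  exact le_min (by linarith [(p e).2.2]) (le_max_of_le_right (by linarith))

end GoodData

end EdgeLCB

/-! ### The performance gap -/

variable {V : Type*} [Fintype V] [DecidableEq V] {E : Finset (V × V)}

/-- A solver that is run with edge probabilities `w ≤ p` loses, compared with the optimum, at most
the drop of the spread of the optimal seed set from `p` to `w`. Self-loops are exempt from both
hypotheses on `w`, since they have no influence on the spread. -/
lemma gap_le_of_edge_bounds {p w : E → I} {k : ℕ} {α : ℝ} (hα₁ : α ≤ 1)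
    {IM : (E → I) → Finset V} (hIM : IsApproxSolver k α IM) {S : Finset V} (hS : S.card ≤ k)
    {ε : ℝ} (hε₀ : 0 ≤ ε)
    (hle : ∀ e : E, (e : V × V).1 ≠ (e : V × V).2 → w e ≤ p e)
    (hε : ∀ e ∈ triggeredEdges p S, (e : V × V).1 ≠ (e : V × V).2 → (p e : ℝ) - w e ≤ ε) :
    α * spread p S - spread p (IM w)
      ≤ ε * (Fintype.card V * (maxOutDegree E * spread p S)) := by
  -- replacing the weights of the self-loops does not change any spread
  set w' : E → I := fun e => if (e : V × V).1 = (e : V × V).2 then p e else w e with hw'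
  have hspread : ∀ T, spread w T = spread w' T := fun T =>
    spread_congr (fun e he => by simp [hw', he]) T
  have hle' : w' ≤ p := fun e => by
    by_cases he : (e : V × V).1 = (e : V × V).2
    · simp [hw', he]
    · simpa [hw', he] using hle e he
  have hdrop := spread_sub_le_of_triggered hle' S hε₀ fun e he => by
    by_cases hloop : (e : V × V).1 = (e : V × V).2
    · simpa [hw', hloop] using hε₀
    · simpa [hw', hloop] using hε e he hloop
  have h₁ := (hIM w).2 S hS
  rw [hspread, hspread] at h₁
  have h₂ := spread_mono hle' (IM w)
  have h₃ := spread_mono hle' S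
  nlinarith [mul_nonneg (sub_nonneg.2 hα₁) (sub_nonneg.2 h₃)]

end OfflineIM

theorem theorem4 {V : Type*} [Fintype V] [DecidableEq V]
    (E : Finset (V × V)) (hE : E.Nonempty)
    (p : E → unitInterval) (q : V → unitInterval)
    (k : ℕ) (α : ℝ) (hα₀ : 0 < α) (hα₁ : α ≤ 1)
    (IM : (E → unitInterval) → Finset V) (hIM : OfflineIM.IsApproxSolver k α IM)
    (Sopt : Finset V) (hSopt : OfflineIM.IsOptimalSeedSet p k Sopt)
    (η γ : ℝ) (hη₀ : 0 < η) (hη₁ : η ≤ 1) (hγ₀ : 0 < γ) (hγ₁ : γ ≤ 1 / 2)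
    (hcov : ∀ e ∈ OfflineIM.triggeredEdges p Sopt,
      (q (e : V × V).1 : ℝ) ∈ Set.Icc γ (1 - γ) ∧
        η ≤ OfflineIM.probInactive q p (e : V × V).2)
    (δ : ℝ) (hδ₀ : 0 < δ) (hδ₁ : δ < 1)
    (n : ℕ) (hn₀ : 1 ≤ n)
    (hn : 392 * Real.log (12 * n * E.card / δ) / (η * γ) ≤ (n : ℝ)) :
    1 - δ ≤ (OfflineIM.dataMeasure n q p).real
      {x | α * OfflineIM.spread p Sopt
            - OfflineIM.spread p (OfflineIM.clcbIMN (OfflineIM.dataset x) E IM δ)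
          ≤ 48 * √6 * √((Fintype.card V : ℝ) ^ 2 * (OfflineIM.maxOutDegree E : ℝ) ^ 2
              * OfflineIM.spread p Sopt ^ 2 * Real.log (12 * n * E.card / δ)
              / (η * γ ^ 3 * n))} := by
  have hn₁ : (1 : ℝ) ≤ n := Nat.one_le_cast.2 hn₀
  have hE₁ : (1 : ℝ) ≤ E.card := Nat.one_le_cast.2 hE.card_pos
  have hnE : (1 : ℝ) ≤ n * E.card := one_le_mul_of_one_le_of_one_le hn₁ hE₁
  have harg : 1 < 12 * n * E.card / δ := by
    rw [one_lt_div hδ₀]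
    linarith
  set L := Real.log (12 * n * E.card / δ) with hL_def
  have hL : 0 < L := Real.log_pos harg
  have hln : 392 * (L / n) ≤ η * γ := by
    rw [div_le_iff₀ (by positivity)] at hn
    rw [← mul_div_assoc, div_le_iff₀ (by positivity)]
    linarith
  have : IsProbabilityMeasure (OfflineIM.dataMeasure n q p) := by
    unfold OfflineIM.dataMeasure
    infer_instance
  have hbad := OfflineIM.measureReal_not_goodData_le q p hn₀ hL
  rw [hL_def, Real.exp_neg, Real.exp_log (by linarith), inv_div, ← hL_def] at hbad
  have hbad' : 6 * n * E.card * (δ / (12 * n * E.card)) ≤ δ := by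
    have : 6 * (n : ℝ) * E.card * (δ / (12 * n * E.card)) = δ / 2 := by
      field_simp
      norm_num
    linarith
  have hcompl := probReal_compl_eq_one_sub (μ := OfflineIM.dataMeasure n q p)
    (s := {x | ¬ OfflineIM.GoodData q p L (OfflineIM.dataset x)}) .of_discrete
  refine le_trans (by linarith) (measureReal_mono (?_ :
    {x | ¬ OfflineIM.GoodData q p L (OfflineIM.dataset x)}ᶜ ⊆ _))
  intro x hx
  have hgood : OfflineIM.GoodData q p L (OfflineIM.dataset x) := not_not.1 hx
  set ε := √(L / (η * γ ^ 3 * n)) with hε_def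
  have hε₀ : 0 ≤ ε := Real.sqrt_nonneg _
  have hgap := OfflineIM.gap_le_of_edge_bounds hα₁ hIM hSopt.1
    (show 0 ≤ 42 * ε by positivity)
    (fun e he => hgood.edgeLCB_le hL hn₀ e he)
    (fun e he hloop => hgood.sub_edgeLCB_le hL hn₀ e hloop hη₀ hη₁ hγ₀ (hcov e he).1 (hcov e he).2
      hln)
  have hσ := OfflineIM.spread_nonneg p Sopt
  have hsqrt : √((Fintype.card V : ℝ) ^ 2 * (OfflineIM.maxOutDegree E : ℝ) ^ 2
      * OfflineIM.spread p Sopt ^ 2 * L / (η * γ ^ 3 * n))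
        = Fintype.card V * (OfflineIM.maxOutDegree E * OfflineIM.spread p Sopt) * ε := by
    rw [← mul_pow, ← mul_pow, mul_div_assoc, Real.sqrt_mul (sq_nonneg _),
      Real.sqrt_sq (by positivity), mul_assoc (Fintype.card V : ℝ)]
  have h6 : 1 ≤ √6 := Real.one_le_sqrt.2 (by norm_num)
  rw [Set.mem_ofPred_eq, hsqrt]
  refine hgap.trans ?_
  calc 42 * ε * (Fintype.card V * (OfflineIM.maxOutDegree E * OfflineIM.spread p Sopt))
      = 42 * (Fintype.card V * (OfflineIM.maxOutDegree E * OfflineIM.spread p Sopt) * ε) := by ring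
    _ ≤ _ := by
      gcongr
      linarith
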